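/- Let $B$ be a complex Hermitian $n\times n$ matrix with eigenvalues $\lambda_1,\dots,\lambda_n$ (listed with multiplicity), and let $b_1,b_n$ be real numbers with $b_1 I\le B\le b_n I$ in the positive semidefinite order (so all $\lambda_i$ lie in $[b_1,b_n]$; the numbers $b_1,b_n$ need not be eigenvalues of $B$). Let $f$ be a real function that is concave or convex on $[b_1,b_n]$ and that, as a function on $[b_1,b_n]$, is differentiable at $b_1$, at $b_n$ and at every $\lambda_i$, with finite derivative $f'$ (one-sided at the end points of the interval; if $b_1=b_n$, $f'(b_1)$ may be any real number). Let $L$ be the Loewner matrix of $f$ at $B$, that is, the $n\times n$ matrix with $$L_{ij}=\begin{cases}\dfrac{f(\lambda_i)-f(\lambda_j)}{\lambda_i-\lambda_j}, & \lambda_i\ne\lambda_j,\\[2mm] f'(\lambda_i), & \lambda_i=\lambda_j,\end{cases}$$ let $S_L:A\mapsto L\circ A$, $(L\circ A)_{ij}=L_{ij}A_{ij}$, be the Schur multiplier operator on the complex $n\times n$ matrices, and let $\|S_L\|=\sup_{A\neq0}\|L\circ A\|/\|A\|$ be its norm induced by the operator (spectral) norm of matrices. Then $$\|S_L\|\le|\alpha-\beta|\,\bigl(1+(n-1)\phi^{-1}\bigr)+\min(|\alpha|,|\beta|),$$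 where $\alpha=f'(b_1)$, $\beta=f'(b_n)$ and $\phi=(1+\sqrt5)/2$ is the golden ratio. -/

import Mathlib

open scoped Matrix ComplexOrder Matrix.Norms.L2Operator

noncomputable section

/-- The Loewner matrix of `f`, with derivative `f'`, at a Hermitian matrix with eigenvalues `b i`:
the divided differences of `f`, and the derivative where two eigenvalues coincide. -/
def loewnerMatrix {n : ℕ} (f f' : ℝ → ℝ) (b : Fin n → ℝ) : Matrix (Fin n) (Fin n) ℂ :=
  Matrix.of fun i j =>
    (((if b i = b j then f' (b i) else (f (b i) - f (b j)) / (b i - b j)) : ℝ) : ℂ)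

/-- The Schur multiplier operator `A ↦ L ⊙ A` on complex `n × n` matrices. -/
def schurMultiplier {n : ℕ} (L : Matrix (Fin n) (Fin n) ℂ) :
    Matrix (Fin n) (Fin n) ℂ →ₗ[ℂ] Matrix (Fin n) (Fin n) ℂ where
  toFun A := L ⊙ A
  map_add' A A' := Matrix.hadamard_add L A A'
  map_smul' c A := Matrix.hadamard_smul L A c

/-- The norm of the Schur multiplier operator induced by the operator (spectral) norm of matrices,
that is, the supremum of `‖L ⊙ A‖ / ‖A‖`.  The scoped norm on matrices is the `ℓ²` operator norm. -/
def schurNorm {n : ℕ} (L : Matrix (Fin n) (Fin n) ℂ) : ℝ :=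
  ‖LinearMap.toContinuousLinearMap (schurMultiplier L)‖

end

/-! For convex `f`, each entry `L i j` lies between `c i` and `c j`, where `c i = f' (b i) ∈ [α,
β]`; nothing else about `L` is used. Add indices in decreasing order of `c`. When `a` joins `s`, `L
- c a` has a zero corner and a border bounded by `β - c a`, and a border row or column merely
rescales a vector. Per unit of `(β - c a) ‖A‖`, the new form is thus controlled by `[[m, 1], [1,
0]]`, with `m` the factor for `s`, so each index adds at most `φ⁻¹` (`norm_hadamardForm_le`).
Restoring the subtracted constant costs `|α|`, or `|β|` after a change of sign. -/

/-- The norm of `[[m, 1], [1, 0]]` is at most `m + φ⁻¹` when `1 ≤ m`. -/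
lemma bordered_form_le {m X Y p q : ℝ} (hm : 1 ≤ m) :
    m * X * Y + p * Y + X * q ≤
      (m + Real.goldenRatio⁻¹) * (√(p ^ 2 + X ^ 2) * √(q ^ 2 + Y ^ 2)) := by
  set g := Real.goldenRatio⁻¹ with hg
  have hg0 : 0 < g := inv_pos.2 Real.goldenRatio_pos
  have hg1 : g ^ 2 + g = 1 := by
    have h := Real.goldenConj_sq
    rw [hg, Real.inv_goldenRatio]
    linarith [neg_sq Real.goldenConj]
  set K := m + g with hK
  have hKg : 1 ≤ K * g := by nlinarith
  have hK0 : 0 < K := by linarith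
  -- This is `‖T (Y, q)‖² ≤ K² ‖(Y, q)‖²` for `T = [[m, 1], [1, 0]]`; the cross term is absorbed by
  -- AM-GM, as `K * g ≥ g + g² = 1`.
  have key : (m * Y + q) ^ 2 + Y ^ 2 ≤ K ^ 2 * (q ^ 2 + Y ^ 2) := by
    have h1 : K * m ≤ K ^ 2 - 1 := by nlinarith
    have h2 : m * g ≤ K ^ 2 - m ^ 2 - 1 := by nlinarith
    have h3 : m * (2 * Y * q) ≤ m * (g * Y ^ 2 + K * q ^ 2) := by
      refine mul_le_mul_of_nonneg_left ?_ (by linarith)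
      have h4 : g * (2 * Y * q) ≤ g * (g * Y ^ 2 + K * q ^ 2) := by
        nlinarith [sq_nonneg (g * Y - q), mul_le_mul_of_nonneg_right hKg (sq_nonneg q)]
      exact le_of_mul_le_mul_left h4 hg0
    nlinarith [mul_le_mul_of_nonneg_right h1 (sq_nonneg q),
      mul_le_mul_of_nonneg_right h2 (sq_nonneg Y)]
  calc m * X * Y + p * Y + X * q
      ≤ √(p ^ 2 + X ^ 2) * √((m * Y + q) ^ 2 + Y ^ 2) := by
        rw [← Real.sqrt_mul (by positivity)]
        refine Real.le_sqrt_of_sq_le ?_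
        nlinarith [sq_nonneg (X * Y - p * (m * Y + q))]
    _ ≤ √(p ^ 2 + X ^ 2) * (K * √(q ^ 2 + Y ^ 2)) := by
        refine mul_le_mul_of_nonneg_left ?_ (Real.sqrt_nonneg _)
        calc _ ≤ √(K ^ 2 * (q ^ 2 + Y ^ 2)) := Real.sqrt_le_sqrt key
          _ = _ := by rw [Real.sqrt_mul (sq_nonneg K), Real.sqrt_sq hK0.le]
    _ = _ := by ring

/-! ### Bilinear forms of Hadamard products -/

/-- The Euclidean norm of the restriction of `x` to `s`. -/
noncomputable def l2On {ι : Type*} (s : Finset ι) (x : ι → ℂ) : ℝ := √(∑ i ∈ s, ‖x i‖ ^ 2)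

lemma l2On_nonneg {ι : Type*} (s : Finset ι) (x : ι → ℂ) : 0 ≤ l2On s x := Real.sqrt_nonneg _

lemma l2On_singleton {ι : Type*} (a : ι) (x : ι → ℂ) : l2On {a} x = ‖x a‖ := by
  simp [l2On]

lemma l2On_insert {ι : Type*} [DecidableEq ι] {a : ι} {s : Finset ι} (ha : a ∉ s) (x : ι → ℂ) :
    l2On (insert a s) x = √(‖x a‖ ^ 2 + l2On s x ^ 2) := by
  rw [l2On, Finset.sum_insert ha, l2On,
    Real.sq_sqrt (Finset.sum_nonneg fun _ _ => sq_nonneg _)]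

lemma l2On_ofReal_mul_le {ι : Type*} (s : Finset ι) (v : ι → ℝ) (x : ι → ℂ) {D : ℝ} (hD : 0 ≤ D)
    (hv : ∀ i ∈ s, |v i| ≤ D) : l2On s (fun i => (v i : ℂ) * x i) ≤ D * l2On s x := by
  rw [show D * l2On s x = √(D ^ 2 * ∑ i ∈ s, ‖x i‖ ^ 2) by
    rw [Real.sqrt_mul (sq_nonneg D), Real.sqrt_sq hD, l2On], l2On, Finset.mul_sum]
  refine Real.sqrt_le_sqrt (Finset.sum_le_sum fun i hi => ?_)
  rw [norm_mul, mul_pow, Complex.norm_real, Real.norm_eq_abs]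
  have := hv i hi
  gcongr

/-- `A` has norm at most `N`, expressed through the blocks of its bilinear form. -/
def FormBound {ι : Type*} (A : Matrix ι ι ℂ) (N : ℝ) : Prop :=
  ∀ (s t : Finset ι) (x y : ι → ℂ),
    ‖∑ i ∈ s, ∑ j ∈ t, x i * A i j * y j‖ ≤ N * (l2On s x * l2On t y)

/-- The bilinear form on `s × s` of the Hadamard product of `M - d` and `A`. -/
def hadamardForm {ι : Type*} (M : Matrix ι ι ℝ) (A : Matrix ι ι ℂ) (d : ℝ) (s : Finset ι)
    (x y : ι → ℂ) : ℂ :=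
  ∑ i ∈ s, ∑ j ∈ s, x i * (((M i j - d : ℝ) : ℂ) * A i j) * y j

/-- The Hadamard product of a constant matrix with `A` is a multiple of `A`. -/
lemma norm_hadamardForm_shift_le {ι : Type*} (M : Matrix ι ι ℝ) {A : Matrix ι ι ℂ} {N : ℝ}
    (hA : FormBound A N) (d e : ℝ) (s : Finset ι) (x y : ι → ℂ) :
    ‖hadamardForm M A d s x y‖ ≤
      ‖hadamardForm M A e s x y‖ + |e - d| * (N * (l2On s x * l2On s y)) := by
  have h : hadamardForm M A d s x y = hadamardForm M A e s x y +
      ((e - d : ℝ) : ℂ) * ∑ i ∈ s, ∑ j ∈ s, x i * A i j * y j := by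
    simp only [hadamardForm, Finset.mul_sum, ← Finset.sum_add_distrib]
    refine Finset.sum_congr rfl fun i _ => Finset.sum_congr rfl fun j _ => ?_
    push_cast
    ring
  rw [h]
  refine (norm_add_le _ _).trans ?_
  rw [norm_mul, Complex.norm_real, Real.norm_eq_abs]
  gcongr
  exact hA s s x y

/-- Bordering by a row and column on which `M - d` is at most `D`, with a zero corner. -/
lemma norm_hadamardForm_insert_le {ι : Type*} [DecidableEq ι] (M : Matrix ι ι ℝ)
    {A : Matrix ι ι ℂ} {N D d : ℝ} (hA : FormBound A N) (hN : 0 ≤ N) (hD : 0 ≤ D)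
    {a : ι} {s : Finset ι} (ha : a ∉ s) (hd : M a a = d)
    (hrow : ∀ j ∈ s, |M a j - d| ≤ D) (hcol : ∀ i ∈ s, |M i a - d| ≤ D) (x y : ι → ℂ) :
    ‖hadamardForm M A d (insert a s) x y‖ ≤
      ‖hadamardForm M A d s x y‖ + D * (N * (‖x a‖ * l2On s y)) +
        D * (N * (l2On s x * ‖y a‖)) := by
  -- The row factors are moved into `y` and the column factors into `x`, so the cost is `D` whatever
  -- the size of `s`.
  have hr := hA {a} s x (fun j => ((M a j - d : ℝ) : ℂ) * y j)
  have hc := hA s {a} (fun i => ((M i a - d : ℝ) : ℂ) * x i) y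
  have hr' := l2On_ofReal_mul_le s (fun j => M a j - d) y hD hrow
  have hc' := l2On_ofReal_mul_le s (fun i => M i a - d) x hD hcol
  rw [l2On_singleton] at hr hc
  simp only [Finset.sum_singleton] at hr hc
  have h : hadamardForm M A d (insert a s) x y = hadamardForm M A d s x y +
      ∑ j ∈ s, x a * A a j * (((M a j - d : ℝ) : ℂ) * y j) +
      ∑ i ∈ s, ((M i a - d : ℝ) : ℂ) * x i * A i a * y a := by
    simp only [hadamardForm, Finset.sum_insert ha, Finset.sum_add_distrib, hd, sub_self]
    have h1 : ∑ j ∈ s, x a * (((M a j - d : ℝ) : ℂ) * A a j) * y j =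
        ∑ j ∈ s, x a * A a j * (((M a j - d : ℝ) : ℂ) * y j) :=
      Finset.sum_congr rfl fun j _ => by ring
    have h2 : ∑ i ∈ s, x i * (((M i a - d : ℝ) : ℂ) * A i a) * y a =
        ∑ i ∈ s, ((M i a - d : ℝ) : ℂ) * x i * A i a * y a :=
      Finset.sum_congr rfl fun j _ => by ring
    rw [h1, h2, Complex.ofReal_zero]
    ring
  rw [h]
  refine (norm_add₃_le).trans ?_
  have hr2 : N * (‖x a‖ * l2On s (fun j => ((M a j - d : ℝ) : ℂ) * y j)) ≤
      D * (N * (‖x a‖ * l2On s y)) := by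
    calc _ ≤ N * (‖x a‖ * (D * l2On s y)) := by gcongr
      _ = _ := by ring
  have hc2 : N * (l2On s (fun i => ((M i a - d : ℝ) : ℂ) * x i) * ‖y a‖) ≤
      D * (N * (l2On s x * ‖y a‖)) := by
    calc _ ≤ N * ((D * l2On s x) * ‖y a‖) := by gcongr
      _ = _ := by ring
  linarith

/-- Induction removing the index of least `c`. The bound `α` stays general because the hypothesis
for `s` is used at `c a`. -/
lemma norm_hadamardForm_le {ι : Type*} [DecidableEq ι] {M : Matrix ι ι ℝ} {A : Matrix ι ι ℂ}
    {N : ℝ} (hA : FormBound A N) (hN : 0 ≤ N) {c : ι → ℝ}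
    (hM : ∀ i j, M i j ∈ Set.uIcc (c i) (c j)) {β : ℝ} (hβ : ∀ i, c i ≤ β) (s : Finset ι) :
    ∀ α, (∀ i ∈ s, α ≤ c i) → s.Nonempty → ∀ x y : ι → ℂ,
      ‖hadamardForm M A α s x y‖ ≤
        (β - α) * (1 + ((s.card : ℝ) - 1) * Real.goldenRatio⁻¹) *
          (N * (l2On s x * l2On s y)) := by
  have hg : 0 < Real.goldenRatio⁻¹ := inv_pos.2 Real.goldenRatio_pos
  induction s using Finset.induction_on_min_value c with
  | empty => rintro α - ⟨i, hi⟩; simp at hi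
  | insert a s ha hmin ih =>
    intro α hα _ x y
    have hαa : α ≤ c a := hα a (Finset.mem_insert_self _ _)
    have haa : M a a = c a := by simpa using hM a a
    have hbd : ∀ j ∈ s, |M a j - c a| ≤ β - c a ∧ |M j a - c a| ≤ β - c a := by
      intro j hj
      have h1 := hM a j
      have h2 := hM j a
      rw [Set.uIcc_of_le (hmin j hj)] at h1
      rw [Set.uIcc_of_ge (hmin j hj)] at h2
      have := hβ j
      exact ⟨abs_le.2 ⟨by linarith [h1.1, h1.2], by linarith [h1.2]⟩,
        abs_le.2 ⟨by linarith [h2.1, h2.2], by linarith [h2.2]⟩⟩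
    have hD : 0 ≤ β - c a := sub_nonneg.2 (hβ a)
    have hins := norm_hadamardForm_insert_le M hA hN hD ha haa (fun j hj => (hbd j hj).1)
      (fun j hj => (hbd j hj).2) x y
    have hshift := norm_hadamardForm_shift_le M hA α (c a) (insert a s) x y
    rw [abs_of_nonneg (sub_nonneg.2 hαa)] at hshift
    set Z := N * (l2On (insert a s) x * l2On (insert a s) y) with hZ
    have hZ0 : 0 ≤ Z := mul_nonneg hN (mul_nonneg (l2On_nonneg _ _) (l2On_nonneg _ _))
    rw [Finset.card_insert_of_notMem ha, Nat.cast_add, Nat.cast_one, add_sub_cancel_right]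
    -- Going back from `c a` to `α` costs `(c a - α) * Z`, which fits because the golden factor is
    -- at least `1`.
    suffices hmain : ‖hadamardForm M A (c a) (insert a s) x y‖ ≤
        (β - c a) * (1 + (s.card : ℝ) * Real.goldenRatio⁻¹) * Z by
      have : 0 ≤ (c a - α) * ((s.card : ℝ) * Real.goldenRatio⁻¹ * Z) :=
        mul_nonneg (sub_nonneg.2 hαa) (by positivity)
      linarith
    refine hins.trans ?_
    rcases s.eq_empty_or_nonempty with rfl | hs
    · simpa [hadamardForm, l2On] using mul_nonneg hD hZ0
    · have hIH := ih (c a) hmin hs x y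
      have hcard : (1 : ℝ) ≤ s.card := by exact_mod_cast hs.card_pos
      have hb := bordered_form_le (X := l2On s x) (Y := l2On s y) (p := ‖x a‖) (q := ‖y a‖)
        (show 1 ≤ 1 + ((s.card : ℝ) - 1) * Real.goldenRatio⁻¹ from
          le_add_of_nonneg_right (mul_nonneg (sub_nonneg.2 hcard) hg.le))
      rw [← l2On_insert ha, ← l2On_insert ha] at hb
      have hb' := mul_le_mul_of_nonneg_left hb (mul_nonneg hD hN)
      rw [hZ]
      linarith

/-! ### Operator norm and bilinear forms -/

lemma formBound_of_l2_opNorm {n : ℕ} (A : Matrix (Fin n) (Fin n) ℂ) : FormBound A ‖A‖ := by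
  intro s t x y
  have hl : ∀ (s : Finset (Fin n)) (x : Fin n → ℂ),
      ‖(WithLp.toLp 2 fun i => if i ∈ s then x i else 0 : EuclideanSpace ℂ (Fin n))‖ =
        l2On s x := by
    intro s x
    rw [EuclideanSpace.norm_eq, l2On,
      Finset.sum_congr rfl (g := fun i => if i ∈ s then ‖x i‖ ^ 2 else 0)]
    · simp
    · intro i _
      by_cases h : i ∈ s <;> simp [h]
  set u : EuclideanSpace ℂ (Fin n) := WithLp.toLp 2 fun i => if i ∈ s then star (x i) else 0
    with hu
  set w : EuclideanSpace ℂ (Fin n) := WithLp.toLp 2 fun i => if i ∈ t then y i else 0 with hw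
  have hun : ‖u‖ = l2On s x := by
    rw [hu, hl]; simp [l2On]
  have hsum : ∑ i ∈ s, ∑ j ∈ t, x i * A i j * y j =
      inner ℂ u (Matrix.toEuclideanCLM (n := Fin n) (𝕜 := ℂ) A w) := by
    simp only [PiLp.inner_apply, Matrix.ofLp_toEuclideanCLM, Matrix.mulVec, dotProduct, hu, hw,
      RCLike.inner_apply]
    simp [Finset.mul_sum, apply_ite, mul_comm, mul_left_comm]
  rw [hsum]
  calc _ ≤ ‖u‖ * ‖Matrix.toEuclideanCLM (n := Fin n) (𝕜 := ℂ) A w‖ := norm_inner_le_norm _ _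
    _ ≤ ‖u‖ * (‖A‖ * ‖w‖) := by
        gcongr
        exact (Matrix.toEuclideanCLM (n := Fin n) (𝕜 := ℂ) A).le_opNorm w
    _ = _ := by rw [hun, hw, hl]; ring

lemma l2_opNorm_le_of_form {n : ℕ} (A : Matrix (Fin n) (Fin n) ℂ) {K : ℝ} (hK : 0 ≤ K)
    (h : ∀ x y : Fin n → ℂ, ‖∑ i, ∑ j, x i * A i j * y j‖ ≤
      K * (l2On Finset.univ x * l2On Finset.univ y)) : ‖A‖ ≤ K := by
  rw [← Matrix.l2_opNorm_toEuclideanCLM]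
  refine ContinuousLinearMap.opNorm_le_bound _ hK fun w => ?_
  set z := Matrix.toEuclideanCLM (n := Fin n) (𝕜 := ℂ) A w with hz
  have hsum : ∑ i, ∑ j, star (z i) * A i j * w j = inner ℂ z z := by
    simp only [PiLp.inner_apply, RCLike.inner_apply]
    refine Finset.sum_congr rfl fun i _ => ?_
    nth_rw 2 [hz]
    simp only [Matrix.mulVec, dotProduct, Finset.sum_mul, Matrix.ofLp_toEuclideanCLM,
      starRingEnd_apply]
    exact Finset.sum_congr rfl fun j _ => by ring
  have hl : ∀ v : EuclideanSpace ℂ (Fin n), l2On Finset.univ (fun i => v i) = ‖v‖ :=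
    fun v => (EuclideanSpace.norm_eq v).symm
  have hl' : l2On Finset.univ (fun i => star (z i)) = ‖z‖ := by
    rw [← hl]; simp [l2On]
  -- Testing on the conjugate of `z = A w` and on `w` gives `‖z‖² ≤ K ‖z‖ ‖w‖`.
  have h1 := h (fun i => star (z i)) (fun i => w i)
  rw [hsum, hl', hl, inner_self_eq_norm_sq_to_K, norm_pow] at h1
  simp only [RCLike.norm_ofReal, abs_norm] at h1
  rcases (norm_nonneg z).eq_or_lt with h0 | h0
  · rw [← h0]; positivity
  · refine le_of_mul_le_mul_left ?_ h0
    linarith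

/-! ### Norm of the Schur multiplier -/

lemma schurNorm_neg {n : ℕ} (L : Matrix (Fin n) (Fin n) ℂ) : schurNorm (-L) = schurNorm L := by
  have : schurMultiplier (-L) = -schurMultiplier L := by
    ext A : 1
    exact Matrix.ext fun i j => by simp [schurMultiplier]
  rw [schurNorm, this, map_neg, norm_neg, schurNorm]

lemma goldenBound_nonneg (n : ℕ) : 0 ≤ 1 + ((n : ℝ) - 1) * Real.goldenRatio⁻¹ := by
  have h1 : Real.goldenRatio⁻¹ ≤ 1 := inv_le_one_of_one_le₀ Real.one_lt_goldenRatio.le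
  have h2 : 0 ≤ (n : ℝ) * Real.goldenRatio⁻¹ :=
    mul_nonneg n.cast_nonneg (inv_nonneg.2 Real.goldenRatio_pos.le)
  linarith

lemma schurNorm_le_left {n : ℕ} {M : Matrix (Fin n) (Fin n) ℝ} {c : Fin n → ℝ}
    (hM : ∀ i j, M i j ∈ Set.uIcc (c i) (c j)) {α β : ℝ} (hαβ : α ≤ β)
    (hc : ∀ i, c i ∈ Set.Icc α β) :
    schurNorm (M.map fun r => (r : ℂ)) ≤
      (β - α) * (1 + ((n : ℝ) - 1) * Real.goldenRatio⁻¹) + |α| := by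
  have hK : 0 ≤ (β - α) * (1 + ((n : ℝ) - 1) * Real.goldenRatio⁻¹) + |α| :=
    add_nonneg (mul_nonneg (sub_nonneg.2 hαβ) (goldenBound_nonneg n)) (abs_nonneg _)
  refine ContinuousLinearMap.opNorm_le_bound _ hK fun A => ?_
  refine l2_opNorm_le_of_form _ (mul_nonneg hK (norm_nonneg A)) fun x y => ?_
  have hA := formBound_of_l2_opNorm A
  have h0 : ∑ i, ∑ j, x i * (LinearMap.toContinuousLinearMap
      (schurMultiplier (M.map fun r => (r : ℂ))) A) i j * y j =
        hadamardForm M A 0 Finset.univ x y := by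
    simp [hadamardForm, schurMultiplier]
  rw [h0]
  rcases n.eq_zero_or_pos with rfl | hn
  · simp [hadamardForm, l2On]
  have : Nonempty (Fin n) := ⟨⟨0, hn⟩⟩
  have h1 := norm_hadamardForm_shift_le M hA 0 α Finset.univ x y
  have h2 := norm_hadamardForm_le hA (norm_nonneg A) hM (fun i => (hc i).2) Finset.univ α
    (fun i _ => (hc i).1) Finset.univ_nonempty x y
  rw [Finset.card_univ, Fintype.card_fin] at h2
  rw [sub_zero] at h1
  linarith

lemma schurNorm_le_of_le {n : ℕ} {M : Matrix (Fin n) (Fin n) ℝ} {c : Fin n → ℝ}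
    (hM : ∀ i j, M i j ∈ Set.uIcc (c i) (c j)) {α β : ℝ} (hαβ : α ≤ β)
    (hc : ∀ i, c i ∈ Set.Icc α β) :
    schurNorm (M.map fun r => (r : ℂ)) ≤
      |α - β| * (1 + ((n : ℝ) - 1) * Real.goldenRatio⁻¹) + min |α| |β| := by
  have h1 := schurNorm_le_left hM hαβ hc
  have hM' : ∀ i j, (-M) i j ∈ Set.uIcc (-c i) (-c j) := by
    intro i j
    have h := hM i j
    rw [Set.mem_uIcc] at h ⊢
    simp only [Matrix.neg_apply]
    rcases h with h | h
    · exact Or.inr ⟨by linarith [h.2], by linarith [h.1]⟩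
    · exact Or.inl ⟨by linarith [h.2], by linarith [h.1]⟩
  -- For `-M` the interval is `[-β, -α]`: same length, but the constant restored is now `-β`.
  have h2 := schurNorm_le_left hM' (neg_le_neg hαβ)
    (fun i => ⟨neg_le_neg (hc i).2, neg_le_neg (hc i).1⟩)
  have hneg : ((-M).map fun r => (r : ℂ)) = -(M.map fun r => (r : ℂ)) :=
    Matrix.ext fun i j => by simp
  rw [hneg, schurNorm_neg, abs_neg, show -α - -β = β - α by ring] at h2
  rw [abs_sub_comm, abs_of_nonneg (sub_nonneg.2 hαβ)]
  rcases min_choice |α| |β| with h | h <;> rw [h] <;> assumption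

/-! ### Eigenvalues and convexity -/

/-- A root of the characteristic polynomial has an eigenvector, on which both semidefinite
inequalities are evaluated. -/
lemma root_mem_Icc {n : ℕ} {B : Matrix (Fin n) (Fin n) ℂ} {b : Fin n → ℝ}
    (hb : B.charpoly = ∏ i, (Polynomial.X - Polynomial.C (b i : ℂ))) {b₁ bₙ : ℝ}
    (hlower : (B - (b₁ : ℂ) • (1 : Matrix (Fin n) (Fin n) ℂ)).PosSemidef)
    (hupper : ((bₙ : ℂ) • (1 : Matrix (Fin n) (Fin n) ℂ) - B).PosSemidef) (i : Fin n) :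
    b i ∈ Set.Icc b₁ bₙ := by
  have hdet : (Matrix.scalar (Fin n) (b i : ℂ) - B).det = 0 := by
    rw [← Matrix.eval_charpoly, hb, Polynomial.eval_prod]
    exact Finset.prod_eq_zero (Finset.mem_univ i) (by simp)
  obtain ⟨v, hv0, hv⟩ := Matrix.exists_mulVec_eq_zero_iff.2 hdet
  have hBv : B.mulVec v = (b i : ℂ) • v := by
    rw [Matrix.sub_mulVec, sub_eq_zero] at hv
    rw [← hv]
    ext k
    simp [Matrix.mulVec_diagonal]
  have hpos : 0 < star v ⬝ᵥ v := Matrix.dotProduct_star_self_pos_iff.2 hv0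
  have h1 := hlower.dotProduct_mulVec_nonneg v
  have h2 := hupper.dotProduct_mulVec_nonneg v
  rw [Matrix.sub_mulVec, hBv, Matrix.smul_mulVec, Matrix.one_mulVec, ← sub_smul,
    dotProduct_smul, smul_eq_mul, ← Complex.ofReal_sub] at h1 h2
  have h1' : 0 ≤ b i - b₁ := Complex.zero_le_real.1 (le_of_mul_le_mul_right (by rwa [zero_mul]) hpos)
  have h2' : 0 ≤ bₙ - b i := Complex.zero_le_real.1 (le_of_mul_le_mul_right (by rwa [zero_mul]) hpos)
  exact ⟨by linarith, by linarith⟩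

/-- The divided differences of `f`, with the value `f'` on coinciding points. -/
noncomputable def dividedDifference {n : ℕ} (f f' : ℝ → ℝ) (b : Fin n → ℝ) : Matrix (Fin n) (Fin n) ℝ :=
  Matrix.of fun i j => if b i = b j then f' (b i) else (f (b i) - f (b j)) / (b i - b j)

/-- A chord slope of a convex function lies between the derivatives at its ends, which also makes
`f'` monotone on the points considered. -/
lemma schurNorm_loewnerMatrix_le_of_convexOn {n : ℕ} {b : Fin n → ℝ} {b₁ bₙ : ℝ}
    (hle : b₁ ≤ bₙ) (hmem : ∀ i, b i ∈ Set.Icc b₁ bₙ) {f f' : ℝ → ℝ}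
    (hf : ConvexOn ℝ (Set.Icc b₁ bₙ) f)
    (hf' : ∀ x ∈ {b₁, bₙ} ∪ Set.range b, HasDerivWithinAt f (f' x) (Set.Icc b₁ bₙ) x) :
    schurNorm (loewnerMatrix f f' b) ≤
      |f' b₁ - f' bₙ| * (1 + ((n : ℝ) - 1) * Real.goldenRatio⁻¹)
        + min |f' b₁| |f' bₙ| := by
  have hslope : ∀ x ∈ {b₁, bₙ} ∪ Set.range b, ∀ y ∈ {b₁, bₙ} ∪ Set.range b,
      x ∈ Set.Icc b₁ bₙ → y ∈ Set.Icc b₁ bₙ → x < y →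
        f' x ≤ (f y - f x) / (y - x) ∧ (f y - f x) / (y - x) ≤ f' y := by
    intro x hx y hy hxI hyI hxy
    rw [← slope_def_field]
    exact ⟨hf.le_slope_of_hasDerivWithinAt hxI hyI hxy (hf' x hx),
      hf.slope_le_of_hasDerivWithinAt hxI hyI hxy (hf' y hy)⟩
  have hmono : ∀ x ∈ {b₁, bₙ} ∪ Set.range b, ∀ y ∈ {b₁, bₙ} ∪ Set.range b,
      x ∈ Set.Icc b₁ bₙ → y ∈ Set.Icc b₁ bₙ → x ≤ y → f' x ≤ f' y := by
    intro x hx y hy hxI hyI hxy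
    rcases hxy.eq_or_lt with rfl | h
    · exact le_rfl
    · exact (hslope x hx y hy hxI hyI h).1.trans (hslope x hx y hy hxI hyI h).2
  have h1 : b₁ ∈ ({b₁, bₙ} ∪ Set.range b : Set ℝ) := by simp
  have hn : bₙ ∈ ({b₁, bₙ} ∪ Set.range b : Set ℝ) := by simp
  have hr : ∀ i, b i ∈ ({b₁, bₙ} ∪ Set.range b : Set ℝ) := fun i => Or.inr ⟨i, rfl⟩
  have h1I := Set.left_mem_Icc.2 hle
  have hnI := Set.right_mem_Icc.2 hle
  refine schurNorm_le_of_le (M := dividedDifference f f' b) (c := fun i => f' (b i)) ?_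
    (hmono _ h1 _ hn h1I hnI hle) fun i =>
      ⟨hmono _ h1 _ (hr i) h1I (hmem i) (hmem i).1, hmono _ (hr i) _ hn (hmem i) hnI (hmem i).2⟩
  intro i j
  simp only [dividedDifference, Matrix.of_apply]
  rcases lt_trichotomy (b i) (b j) with h | h | h
  · rw [if_neg h.ne, ← neg_sub (f (b j)), ← neg_sub (b j), neg_div_neg_eq]
    exact Set.mem_uIcc.2 (Or.inl (hslope _ (hr i) _ (hr j) (hmem i) (hmem j) h))
  · rw [if_pos h]
    exact Set.left_mem_uIcc
  · rw [if_neg h.ne']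
    exact Set.mem_uIcc.2 (Or.inr (hslope _ (hr j) _ (hr i) (hmem j) (hmem i) h))

theorem mainTheorem12 {n : ℕ} (B : Matrix (Fin n) (Fin n) ℂ) (hB : B.IsHermitian)
    -- `b` lists the eigenvalues of `B` with multiplicity
    (b : Fin n → ℝ)
    (hb : B.charpoly = ∏ i, (Polynomial.X - Polynomial.C (b i : ℂ)))
    (b₁ bₙ : ℝ)
    (hlower : (B - (b₁ : ℂ) • (1 : Matrix (Fin n) (Fin n) ℂ)).PosSemidef)
    (hupper : ((bₙ : ℂ) • (1 : Matrix (Fin n) (Fin n) ℂ) - B).PosSemidef)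
    (f f' : ℝ → ℝ)
    (hf : ConcaveOn ℝ (Set.Icc b₁ bₙ) f ∨ ConvexOn ℝ (Set.Icc b₁ bₙ) f)
    -- `f` is differentiable at the eigenvalues and at the end points (there one-sidedly)
    (hf' : ∀ x ∈ {b₁, bₙ} ∪ Set.range b, HasDerivWithinAt f (f' x) (Set.Icc b₁ bₙ) x) :
    schurNorm (loewnerMatrix f f' b) ≤
      |f' b₁ - f' bₙ| * (1 + ((n : ℝ) - 1) * Real.goldenRatio⁻¹)
        + min |f' b₁| |f' bₙ| := by
  -- Without an eigenvalue between them, `b₁ ≤ bₙ` may fail.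
  rcases n.eq_zero_or_pos with rfl | hn
  · refine ContinuousLinearMap.opNorm_le_bound _ (add_nonneg
      (mul_nonneg (abs_nonneg _) (goldenBound_nonneg 0))
      (le_min (abs_nonneg _) (abs_nonneg _))) fun A => ?_
    rw [Subsingleton.elim A 0, map_zero, norm_zero, mul_zero]
  have hmem := root_mem_Icc hb hlower hupper
  have hle : b₁ ≤ bₙ := (hmem ⟨0, hn⟩).1.trans (hmem ⟨0, hn⟩).2
  rcases hf with hf | hf
  · have h := schurNorm_loewnerMatrix_le_of_convexOn hle hmem hf.neg (f' := fun x => -f' x)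
      fun x hx => (hf' x hx).neg
    have hL : loewnerMatrix (-f) (fun x => -f' x) b = -loewnerMatrix f f' b := by
      refine Matrix.ext fun i j => ?_
      simp only [loewnerMatrix, Matrix.of_apply, Matrix.neg_apply, Pi.neg_apply]
      split_ifs
      · simp
      · push_cast
        ring
    rwa [hL, schurNorm_neg, abs_neg, abs_neg, ← neg_sub', abs_neg] at h
  · exact schurNorm_loewnerMatrix_le_of_convexOn hle hmem hf hf'
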